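/- Let $\mathcal V$ be a countably infinite set of variables. A signature is a set of function symbols with fixed arities; for a signature $\mathcal F$ let $\mathcal T(\mathcal F,\mathcal V)$ be the set of terms over $\mathcal F$ and $\mathcal V$, and for a set $X$ of function symbols let $\mathcal T_X(\mathcal F,\mathcal V)$ be the set of those terms in $\mathcal T(\mathcal F,\mathcal V)$ whose root symbol belongs to $X$. A term rewrite system (TRS) over $\mathcal F$ is a set $\mathcal R\subseteq\mathcal T(\mathcal F,\mathcal V)^2$ of rules $\ell\to r$ such that $\ell$ is not a variable and every variable of $r$ occurs in $\ell$; it is confluent if its rewrite relation $\to_{\mathcal R}$ on $\mathcal T(\mathcal F,\mathcal V)$ is confluent, that is, whenever $s\to_{\mathcal R}^* t$ and $s\to_{\mathcal R}^* u$ there is a term $v$ with $t\to_{\mathcal R}^* v$ and $u\to_{\mathcal R}^* v$. Theorem. Let $\mathcal R_1$ and $\mathcal R_2$ be TRSs over signatures $\mathcal F_1$ and $\mathcal F_2$, respectively (a symbol common to both has the same arity in both), and put $\mathcal B=\mathcal F_1\cap\mathcal F_2$, $\mathcal D_1=\mathcal F_1\setminus\mathcal F_2$, $\mathcal D_2=\mathcal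 F_2\setminus\mathcal F_1$. Suppose that $$\mathcal R_1\subseteq\mathcal T(\mathcal B,\mathcal V)^2\cup\mathcal T_{\mathcal D_1}(\mathcal F_1,\mathcal V)^2,\qquad \mathcal R_2\subseteq\mathcal T(\mathcal B,\mathcal V)^2\cup\mathcal T_{\mathcal D_2}(\mathcal F_2,\mathcal V)^2,$$ $$\mathcal R_1\cap\mathcal T(\mathcal B,\mathcal V)^2=\mathcal R_2\cap\mathcal T(\mathcal B,\mathcal V)^2.$$ If $\mathcal R_1$ and $\mathcal R_2$ are confluent, then the TRS $\mathcal R_1\cup\mathcal R_2$ over $\mathcal F_1\cup\mathcal F_2$ is confluent. -/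

import Mathlib

/-! First-order term rewriting. Terms are Mathlib's `FirstOrder.Language.Term`: the function symbols
of an ambient language `L` are the symbols available, each with its arity (relation symbols play no
role), and a signature is a set of these symbols. -/

namespace Rewriting

universe u v w

/-- A function symbol together with its arity. -/
abbrev FunSymbol (L : FirstOrder.Language.{u, v}) : Type u := Σ n : ℕ, L.Functions n

section Terms

variable {L : FirstOrder.Language.{u, v}} {V : Type w}

/-- The set of function symbols occurring in a term. -/
def funs : L.Term V → Set (FunSymbol L)
  | .var _ => ∅
  | .func (l := n) f ts => insert ⟨n, f⟩ (⋃ i, funs (ts i))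

/-- The set of variables occurring in a term. -/
def vars : L.Term V → Set V
  | .var x => {x}
  | .func _ ts => ⋃ i, vars (ts i)

/-- The root symbol of the term is a function symbol in `X`. -/
def HasRootIn (X : Set (FunSymbol L)) : L.Term V → Prop
  | .var _ => False
  | .func (l := n) f _ => ⟨n, f⟩ ∈ X

end Terms

/-- The set `T(F, V)` of terms over the signature `F` with variables in `V`. -/
def termsOver {L : FirstOrder.Language.{u, v}} (F : Set (FunSymbol L)) (V : Type w) :
    Set (L.Term V) :=
  {t | funs t ⊆ F}

/-- The set `T_X(F, V)` of terms over the signature `F` whose root symbol belongs to `X`. -/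
def rootedTermsOver {L : FirstOrder.Language.{u, v}} (X F : Set (FunSymbol L)) (V : Type w) :
    Set (L.Term V) :=
  {t | t ∈ termsOver F V ∧ HasRootIn X t}

/-- A term rewrite system: a signature and a set of rewrite rules over it. Left-hand sides of rules
are not variables, and every variable of a right-hand side occurs in the left-hand side. -/
structure TRS (L : FirstOrder.Language.{u, v}) (V : Type w) where
  sig : Set (FunSymbol L)
  rules : Set (L.Term V × L.Term V)
  rules_subset : rules ⊆ termsOver sig V ×ˢ termsOver sig V
  lhs_ne_var : ∀ ρ ∈ rules, ∀ x : V, ρ.1 ≠ FirstOrder.Language.Term.var x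
  vars_subset : ∀ ρ ∈ rules, vars ρ.2 ⊆ vars ρ.1

/-- Confluence of a relation: any two reducts (in any number of steps) of one element have a common
reduct. -/
def Confluent {α : Type*} (r : α → α → Prop) : Prop :=
  ∀ s t u : α, Relation.ReflTransGen r s t → Relation.ReflTransGen r s u →
    Relation.Join (Relation.ReflTransGen r) t u

namespace TRS

variable {L : FirstOrder.Language.{u, v}} {V : Type w}

/-- One rewrite step: an instance of the left-hand side of a rule, under a substitution into the
terms over the signature, is replaced by the same instance of the right-hand side, at the root or
below an argument position. -/
inductive Step (R : TRS L V) : L.Term V → L.Term V → Prop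
  | rule {l r : L.Term V} (h : (l, r) ∈ R.rules) (σ : V → L.Term V)
      (hσ : ∀ x, σ x ∈ termsOver R.sig V) : Step R (l.subst σ) (r.subst σ)
  | arg {n : ℕ} (f : L.Functions n) (ts : Fin n → L.Term V) (i : Fin n) (t' : L.Term V)
      (h : Step R (ts i) t') :
      Step R (.func f ts) (.func f (Function.update ts i t'))

/-- A TRS is confluent if its rewrite relation on the terms over its signature is confluent. -/
def IsConfluent (R : TRS L V) : Prop :=
  Confluent (fun s t : termsOver R.sig V => R.Step s t)

/-- The union of two TRSs, over the union of their signatures. -/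
def union (R₁ R₂ : TRS L V) : TRS L V where
  sig := R₁.sig ∪ R₂.sig
  rules := R₁.rules ∪ R₂.rules
  rules_subset := by
    rintro ρ (h | h)
    · exact ⟨(R₁.rules_subset h).1.trans Set.subset_union_left,
        (R₁.rules_subset h).2.trans Set.subset_union_left⟩
    · exact ⟨(R₂.rules_subset h).1.trans Set.subset_union_right,
        (R₂.rules_subset h).2.trans Set.subset_union_right⟩
  lhs_ne_var := by
    rintro ρ (h | h)
    · exact R₁.lhs_ne_var ρ h
    · exact R₂.lhs_ne_var ρ h
  vars_subset := by
    rintro ρ (h | h)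
    · exact R₁.vars_subset ρ h
    · exact R₂.vars_subset ρ h

end TRS

end Rewriting

namespace Rewriting

universe u v w

open FirstOrder.Language (Term)
open FirstOrder.Language.Term (var func)
open Relation (ReflTransGen Join)

/-! ### Signatures, root symbols and substitution -/

section TermsLemmas

variable {L : FirstOrder.Language.{u, v}} {V : Type w}

/-! Cut a term at a set `F` of symbols into a top layer over `F` and its aliens, the maximal
subterms that are variables or rooted outside `F`. For `F` either signature or their intersection,
each rule of the union is a rule over `F` of one confluent system or has both sides rooted outside
`F`. Hence an alien rooted outside `F` never merges into the layer above it (`IsLayer.step`).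

Suppose rewriting is confluent at the aliens, and name them by variables, joinable aliens alike. Two
reductions of the term project to its top layer, where the governing system joins them; replacing
each name by a common reduct of its aliens lifts the join back (`IsLayer.confluentAt`). If the root
lies in `F`, the aliens are aliens of the arguments, so induction on terms concludes
(`isConfluent_of_isLayer`). -/

theorem func_mem_termsOver {F : Set (FunSymbol L)} {n : ℕ} {f : L.Functions n}
    {ts : Fin n → L.Term V} :
    (func f ts : L.Term V) ∈ termsOver F V ↔ ⟨n, f⟩ ∈ F ∧ ∀ i, ts i ∈ termsOver F V := by
  simp [termsOver, funs, Set.insert_subset_iff]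

theorem var_mem_termsOver {F : Set (FunSymbol L)} (x : V) :
    (var x : L.Term V) ∈ termsOver F V := by
  simp [termsOver, funs]

theorem termsOver_mono {F G : Set (FunSymbol L)} (h : F ⊆ G) : termsOver F V ⊆ termsOver G V :=
  fun _ ht => Set.Subset.trans ht h

theorem subst_mem_termsOver {F : Set (FunSymbol L)} {t : L.Term V} {σ : V → L.Term V}
    (ht : t ∈ termsOver F V) (hσ : ∀ x ∈ vars t, σ x ∈ termsOver F V) :
    t.subst σ ∈ termsOver F V := by
  induction t with
  | var x => exact hσ x (by simp [vars])
  | func f ts ih =>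
    rw [func_mem_termsOver] at ht
    refine func_mem_termsOver.2 ⟨ht.1, fun i => ih i (ht.2 i) fun x hx => hσ x ?_⟩
    exact Set.mem_iUnion.2 ⟨i, hx⟩

theorem HasRootIn.mono {X Y : Set (FunSymbol L)} (h : X ⊆ Y) {t : L.Term V}
    (ht : HasRootIn X t) : HasRootIn Y t := by
  cases t with
  | var x => exact ht
  | func f ts => exact h ht

theorem HasRootIn.subst {X : Set (FunSymbol L)} {t : L.Term V} (h : HasRootIn X t)
    (σ : V → L.Term V) : HasRootIn X (t.subst σ) := by
  cases t with
  | var x => exact h.elim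
  | func f ts => exact h

end TermsLemmas

/-! ### Confluence at a single element -/

section ConfluentAt

variable {α : Type*}

/-- Any two reducts of `s` have a common reduct. -/
def ConfluentAt (r : α → α → Prop) (s : α) : Prop :=
  ∀ t u : α, ReflTransGen r s t → ReflTransGen r s u → Join (ReflTransGen r) t u

theorem ConfluentAt.of_reduct {r : α → α → Prop} {s t : α} (hs : ConfluentAt r s)
    (h : ReflTransGen r s t) : ConfluentAt r t :=
  fun _ _ h₁ h₂ => hs _ _ (h.trans h₁) (h.trans h₂)

theorem ConfluentAt.join_trans {r : α → α → Prop} {a b c : α} (hb : ConfluentAt r b)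
    (hab : Join (ReflTransGen r) a b) (hbc : Join (ReflTransGen r) b c) :
    Join (ReflTransGen r) a c := by
  obtain ⟨d, had, hbd⟩ := hab
  obtain ⟨e, hbe, hce⟩ := hbc
  obtain ⟨k, hdk, hek⟩ := hb d e hbd hbe
  exact ⟨k, had.trans hdk, hce.trans hek⟩

/-- Finitely many elements joinable with an element at which `r` is confluent have a common
reduct. -/
theorem ConfluentAt.exists_common_reduct {r : α → α → Prop} {a : α} (ha : ConfluentAt r a)
    {J : Set α} (hJ : J.Finite) (h : ∀ b ∈ J, Join (ReflTransGen r) a b) :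
    ∃ c, ReflTransGen r a c ∧ ∀ b ∈ J, ReflTransGen r b c := by
  induction J, hJ using Set.Finite.induction_on with
  | empty => exact ⟨a, .refl, by simp⟩
  | insert _ _ ih =>
    obtain ⟨c, hac, hc⟩ := ih fun b hb => h b (Set.mem_insert_of_mem _ hb)
    obtain ⟨d, had, hbd⟩ := h _ (Set.mem_insert _ _)
    obtain ⟨k, hck, hdk⟩ := ha c d hac had
    refine ⟨k, hac.trans hck, ?_⟩
    rintro b (rfl | hb)
    · exact hbd.trans hdk
    · exact (hc b hb).trans hck

end ConfluentAt

/-- Every finite subset of a type can be mapped injectively into an infinite type. -/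
theorem exists_injOn_of_finite {α : Type*} {β : Type*} [Infinite β] {s : Set α} (hs : s.Finite) :
    ∃ e : α → β, Set.InjOn e s := by
  classical
  have := hs.to_subtype
  have := Fintype.ofFinite s
  let g : s ↪ β := (Fintype.equivFin s).toEmbedding.trans
    (Fin.valEmbedding.trans (Infinite.natEmbedding β))
  refine ⟨fun a => if h : a ∈ s then g ⟨a, h⟩ else Infinite.natEmbedding β 0, fun a ha b hb h => ?_⟩
  simp only [ha, hb, dif_pos] at h
  exact congrArg Subtype.val (g.injective h)

/-! ### Rewrite steps: signatures, substitutions and contexts -/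

namespace TRS

variable {L : FirstOrder.Language.{u, v}} {V : Type w}

theorem Step.mem_termsOver {R : TRS L V} {s t : L.Term V} (h : R.Step s t)
    (hs : s ∈ termsOver R.sig V) : t ∈ termsOver R.sig V := by
  induction h with
  | rule h σ hσ => exact subst_mem_termsOver (R.rules_subset h).2 fun x _ => hσ x
  | arg f ts i t' _ ih =>
    rw [func_mem_termsOver] at hs ⊢
    refine ⟨hs.1, fun j => ?_⟩
    rcases eq_or_ne j i with rfl | hj
    · simpa using ih (hs.2 j)
    · simpa [hj] using hs.2 j

theorem mem_termsOver_of_reduces {R : TRS L V} {s t : L.Term V} (h : ReflTransGen R.Step s t)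
    (hs : s ∈ termsOver R.sig V) : t ∈ termsOver R.sig V := by
  induction h with
  | refl => exact hs
  | tail _ h ih => exact h.mem_termsOver ih

theorem reduces_subtype_iff {R : TRS L V} (s t : termsOver R.sig V) :
    ReflTransGen (fun s t : termsOver R.sig V => R.Step s t) s t ↔
      ReflTransGen R.Step (s : L.Term V) t := by
  refine ⟨fun h => h.lift Subtype.val fun _ _ => id, fun h => ?_⟩
  obtain ⟨t, ht⟩ := t
  dsimp only at h
  induction h with
  | refl => exact .refl
  | tail h₁ h₂ ih => exact (ih (mem_termsOver_of_reduces h₁ s.2)).tail h₂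

theorem isConfluent_iff {R : TRS L V} :
    R.IsConfluent ↔ ∀ s ∈ termsOver R.sig V, ConfluentAt R.Step s := by
  constructor
  · intro h s hs t u ht hu
    obtain ⟨k, hk₁, hk₂⟩ := h ⟨s, hs⟩ ⟨t, mem_termsOver_of_reduces ht hs⟩
      ⟨u, mem_termsOver_of_reduces hu hs⟩ ((reduces_subtype_iff _ _).2 ht)
      ((reduces_subtype_iff _ _).2 hu)
    exact ⟨k, (reduces_subtype_iff _ _).1 hk₁, (reduces_subtype_iff _ _).1 hk₂⟩
  · intro h s t u ht hu
    obtain ⟨k, hk₁, hk₂⟩ := h s s.2 t u ((reduces_subtype_iff _ _).1 ht)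
      ((reduces_subtype_iff _ _).1 hu)
    exact ⟨⟨k, mem_termsOver_of_reduces hk₁ t.2⟩, (reduces_subtype_iff _ _).2 hk₁,
      (reduces_subtype_iff _ _).2 hk₂⟩

theorem not_step_var {R : TRS L V} {x : V} {t : L.Term V} : ¬ R.Step (var x) t := by
  intro h
  generalize hs : (var x : L.Term V) = s at h
  cases h with
  | @rule l r h σ hσ =>
    cases l with
    | var y => exact R.lhs_ne_var _ h y rfl
    | func f ts => simp at hs
  | arg => simp at hs

theorem confluentAt_var {R : TRS L V} (x : V) : ConfluentAt R.Step (var x) := by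
  have key : ∀ {t}, ReflTransGen R.Step (var x) t → t = var x := fun h => by
    induction h with
    | refl => rfl
    | tail _ h ih => subst ih; exact (not_step_var h).elim
  intro t u ht hu
  rw [key ht, key hu]
  exact ⟨_, .refl, .refl⟩

theorem Step.hasRootIn {R : TRS L V} {X : Set (FunSymbol L)}
    (hX : ∀ ρ ∈ R.rules, HasRootIn X ρ.1 → HasRootIn X ρ.2) {s t : L.Term V} (h : R.Step s t)
    (hs : HasRootIn X s) : HasRootIn X t := by
  cases h with
  | @rule l r h σ hσ =>
    refine HasRootIn.subst (hX _ h ?_) σ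
    cases l with
    | var x => exact (R.lhs_ne_var _ h x rfl).elim
    | func f ts => exact hs
  | arg f ts i t' _ => exact hs

theorem Step.subst {R R' : TRS L V} (hsig : R'.sig ⊆ R.sig) (hrules : R'.rules ⊆ R.rules)
    {g : V → L.Term V} (hg : ∀ x, g x ∈ termsOver R.sig V) {s t : L.Term V} (h : R'.Step s t) :
    R.Step (s.subst g) (t.subst g) := by
  have subst_subst : ∀ (t : L.Term V) (σ : V → L.Term V),
      (t.subst σ).subst g = t.subst fun x => (σ x).subst g := fun t σ => by
    induction t with
    | var x => rfl
    | func f ts ih => simp only [Term.subst, ih]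
  induction h with
  | rule h σ hσ =>
    rw [subst_subst, subst_subst]
    exact .rule (hrules h) _ fun x =>
      subst_mem_termsOver (termsOver_mono hsig (hσ x)) fun y _ => hg y
  | arg f ts i t' _ ih =>
    have := Step.arg f (fun j => (ts j).subst g) i _ ih
    simp only [Term.subst]
    convert this using 2
    funext j
    rcases eq_or_ne j i with rfl | hj <;> simp [*]

theorem reduces_update {R : TRS L V} {n : ℕ} (f : L.Functions n) (ts : Fin n → L.Term V)
    (i : Fin n) {t' : L.Term V} (h : ReflTransGen R.Step (ts i) t') :
    ReflTransGen R.Step (func f ts) (func f (Function.update ts i t')) := by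
  induction h with
  | refl => rw [Function.update_eq_self]
  | @tail b c _ h ih =>
    refine ih.tail ?_
    have := Step.arg (R := R) f (Function.update ts i b) i c (by simpa using h)
    simpa using this

theorem reduces_func {R : TRS L V} {n : ℕ} (f : L.Functions n) {ts us : Fin n → L.Term V}
    (h : ∀ i, ReflTransGen R.Step (ts i) (us i)) :
    ReflTransGen R.Step (func f ts) (func f us) := by
  classical
  have key : ∀ s : Finset (Fin n), ReflTransGen R.Step (func f ts) (func f (s.piecewise us ts)) := by
    intro s
    induction s using Finset.induction_on with
    | empty => simpa using ReflTransGen.refl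
    | insert i s hi ih =>
      rw [Finset.piecewise_insert]
      exact ih.trans (reduces_update f _ i (by simpa [hi] using h i))
  simpa using key Finset.univ

end TRS

/-! ### Top layers, aliens and modularity -/

section Layers

variable {L : FirstOrder.Language.{u, v}} {V : Type w}

open Classical in
/-- The maximal subterms that are variables or have a root symbol outside `F`. -/
noncomputable def aliens (F : Set (FunSymbol L)) : L.Term V → Set (L.Term V)
  | .var x => {var x}
  | .func (l := n) f ts => if ⟨n, f⟩ ∈ F then ⋃ i, aliens F (ts i) else {func f ts}

open Classical in
/-- The term over `F` obtained by replacing every alien `a` by the variable `e a`. -/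
noncomputable def topLayer (F : Set (FunSymbol L)) (e : L.Term V → V) : L.Term V → L.Term V
  | .var x => var (e (var x))
  | .func (l := n) f ts =>
      if ⟨n, f⟩ ∈ F then func f fun i => topLayer F e (ts i) else var (e (func f ts))

variable {F : Set (FunSymbol L)}

theorem aliens_finite (t : L.Term V) : (aliens F t).Finite := by
  induction t with
  | var x => simp [aliens]
  | func f ts ih =>
    rw [aliens]
    split_ifs
    · exact Set.finite_iUnion ih
    · exact Set.finite_singleton _

theorem aliens_of_hasRootIn_compl {t : L.Term V} (h : HasRootIn Fᶜ t) : aliens F t = {t} := by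
  cases t with
  | var x => exact h.elim
  | func f ts => exact if_neg h

theorem topLayer_of_hasRootIn_compl {t : L.Term V} (h : HasRootIn Fᶜ t) (e : L.Term V → V) :
    topLayer F e t = var (e t) := by
  cases t with
  | var x => exact h.elim
  | func f ts => exact if_neg h

theorem topLayer_mem_termsOver (e : L.Term V → V) (t : L.Term V) :
    topLayer F e t ∈ termsOver F V := by
  induction t with
  | var x => exact var_mem_termsOver _
  | func f ts ih =>
    rw [topLayer]
    split_ifs with h
    · exact func_mem_termsOver.2 ⟨h, ih⟩
    · exact var_mem_termsOver _

theorem aliens_subst {t : L.Term V} (ht : t ∈ termsOver F V) (σ : V → L.Term V) :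
    aliens F (t.subst σ) = ⋃ x ∈ vars t, aliens F (σ x) := by
  induction t with
  | var x => simp [vars, Term.subst]
  | func f ts ih =>
    rw [func_mem_termsOver] at ht
    simp only [Term.subst, aliens, vars, if_pos ht.1, Set.biUnion_iUnion]
    exact Set.iUnion_congr fun i => ih i (ht.2 i)

theorem topLayer_subst {t : L.Term V} (ht : t ∈ termsOver F V) (e : L.Term V → V)
    (σ : V → L.Term V) :
    topLayer F e (t.subst σ) = t.subst fun x => topLayer F e (σ x) := by
  induction t with
  | var x => rfl
  | func f ts ih =>
    rw [func_mem_termsOver] at ht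
    simp only [Term.subst, topLayer, if_pos ht.1]
    congr 1
    exact funext fun i => ih i (ht.2 i)

namespace TRS

/-- `F` is a layer of `R` governed by `R'`: every rule of `R` is a rule of `R'` over `F`, or both of
its sides have root symbols outside `F`. -/
structure IsLayer (R R' : TRS L V) (F : Set (FunSymbol L)) : Prop where
  subset_sig : F ⊆ R'.sig
  sig_subset : R'.sig ⊆ R.sig
  rules_subset : R'.rules ⊆ R.rules
  rule_cases : ∀ ρ ∈ R.rules,
    (ρ ∈ R'.rules ∧ ρ.1 ∈ termsOver F V ∧ ρ.2 ∈ termsOver F V) ∨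
      (HasRootIn Fᶜ ρ.1 ∧ HasRootIn Fᶜ ρ.2)

/-- A left-hand side rooted outside `F` is not a term over `F`, which excludes the first kind of
rule. -/
theorem IsLayer.hasRootIn_compl {R R' : TRS L V} (hF : R.IsLayer R' F) :
    ∀ ρ ∈ R.rules, HasRootIn Fᶜ ρ.1 → HasRootIn Fᶜ ρ.2 := by
  intro ρ hρ h
  rcases hF.rule_cases ρ hρ with ⟨-, hl, -⟩ | ⟨-, hr⟩
  · obtain ⟨l, r⟩ := ρ
    cases l with
    | var x => exact h.elim
    | func f ts => exact (h (func_mem_termsOver.1 hl).1).elim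
  · exact hr

/-- One step changes the aliens by deletion and by single steps, and the top layer by at most one
step of the system governing the layer. -/
theorem IsLayer.step {R R' : TRS L V} (hF : R.IsLayer R' F) {s t : L.Term V} (h : R.Step s t) :
    (∀ b ∈ aliens F t, ∃ a ∈ aliens F s, ReflTransGen R.Step a b) ∧
      ∀ e : L.Term V → V, (∀ a ∈ aliens F s, ∀ b, R.Step a b → e a = e b) →
        ReflTransGen R'.Step (topLayer F e s) (topLayer F e t) := by
  -- A term rooted outside `F` is its own only alien and remains so after a step; its top layer is a
  -- single name, which `e` keeps.
  have of_compl : ∀ {s t : L.Term V}, R.Step s t → HasRootIn Fᶜ s →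
      (∀ b ∈ aliens F t, ∃ a ∈ aliens F s, ReflTransGen R.Step a b) ∧
        ∀ e : L.Term V → V, (∀ a ∈ aliens F s, ∀ b, R.Step a b → e a = e b) →
          ReflTransGen R'.Step (topLayer F e s) (topLayer F e t) := by
    intro s t h hs
    have ht := h.hasRootIn hF.hasRootIn_compl hs
    simp only [aliens_of_hasRootIn_compl hs, aliens_of_hasRootIn_compl ht,
      topLayer_of_hasRootIn_compl hs, topLayer_of_hasRootIn_compl ht, Set.mem_singleton_iff,
      forall_eq, exists_eq_left]
    exact ⟨.single h, fun e he => by rw [he t h]⟩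
  induction h with
  | @rule l r h σ hσ =>
    rcases hF.rule_cases _ h with ⟨h', hl, hr⟩ | ⟨hl, -⟩
    · rw [aliens_subst hl, aliens_subst hr]
      refine ⟨fun b hb => ?_, fun e _ => ?_⟩
      -- The right-hand side has no new variables, so a rule over `F` only copies or deletes aliens.
      · exact ⟨b, Set.biUnion_mono (R.vars_subset _ h) (fun _ _ => subset_rfl) hb, .refl⟩
      · rw [topLayer_subst hl, topLayer_subst hr]
        exact .single (.rule h' _ fun x =>
          termsOver_mono hF.subset_sig (topLayer_mem_termsOver e _))
    · exact of_compl (.rule h σ hσ) (hl.subst σ)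
  | @arg n f ts i t' h ih =>
    by_cases hf : (⟨n, f⟩ : FunSymbol L) ∈ F
    · simp only [aliens, topLayer, if_pos hf, Set.mem_iUnion]
      refine ⟨?_, fun e he => ?_⟩
      · rintro b ⟨j, hb⟩
        rcases eq_or_ne j i with rfl | hj
        · rw [Function.update_self] at hb
          obtain ⟨a, ha, hab⟩ := ih.1 b hb
          exact ⟨a, ⟨j, ha⟩, hab⟩
        · rw [Function.update_of_ne hj] at hb
          exact ⟨b, ⟨j, hb⟩, .refl⟩
      · refine reduces_func f fun j => ?_
        rcases eq_or_ne j i with rfl | hj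
        · rw [Function.update_self]
          exact ih.2 e fun a ha => he a ⟨j, ha⟩
        · rw [Function.update_of_ne hj]
    · exact of_compl (.arg f ts i t' h) hf

/-- The terms over the signature at which the rewrite relation is confluent. -/
def confluentTerms (R : TRS L V) : Set (L.Term V) :=
  {t | t ∈ termsOver R.sig V ∧ ConfluentAt R.Step t}

theorem mem_confluentTerms_of_reduces {R : TRS L V} {s t : L.Term V}
    (hs : s ∈ R.confluentTerms) (h : ReflTransGen R.Step s t) : t ∈ R.confluentTerms :=
  ⟨mem_termsOver_of_reduces h hs.1, hs.2.of_reduct h⟩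

/-- Joinability of terms at which the rewrite relation is confluent, extended by equality. -/
def joinSetoid (R : TRS L V) : Setoid (L.Term V) where
  r a b := a = b ∨
    a ∈ R.confluentTerms ∧ b ∈ R.confluentTerms ∧ Join (ReflTransGen R.Step) a b
  iseqv :=
    { refl := fun _ => .inl rfl
      symm := by
        rintro a b (rfl | ⟨ha, hb, c, hac, hbc⟩)
        · exact .inl rfl
        · exact .inr ⟨hb, ha, c, hbc, hac⟩
      trans := by
        rintro a b c (rfl | ⟨ha, hb, hab⟩) (rfl | ⟨hb', hc, hbc⟩)
        · exact .inl rfl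
        · exact .inr ⟨hb', hc, hbc⟩
        · exact .inr ⟨ha, hb, hab⟩
        · exact .inr ⟨ha, hc, hb.2.join_trans hab hbc⟩ }

theorem IsLayer.reduces {R R' : TRS L V} (hF : R.IsLayer R' F) {s t : L.Term V}
    (h : ReflTransGen R.Step s t) (hs : aliens F s ⊆ R.confluentTerms) :
    aliens F t ⊆ R.confluentTerms ∧
      ∀ e : L.Term V → V, (∀ a ∈ R.confluentTerms, ∀ b, R.Step a b → e a = e b) →
        ReflTransGen R'.Step (topLayer F e s) (topLayer F e t) := by
  induction h with
  | refl => exact ⟨hs, fun _ _ => .refl⟩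
  | tail _ h ih =>
    refine ⟨fun b hb => ?_, fun e he => (ih.2 e he).trans ?_⟩
    · obtain ⟨a, ha, hab⟩ := (hF.step h).1 b hb
      exact mem_confluentTerms_of_reduces (ih.1 ha) hab
    · exact (hF.step h).2 e fun a ha => he a (ih.1 ha)

/-- Left-linearity plays no role: equally named aliens are all reduced to the same term before a
rule is applied to the top layer. -/
theorem reduces_topLayer_subst {R : TRS L V} {e : L.Term V → V} {g : V → L.Term V} {t : L.Term V}
    (h : ∀ a ∈ aliens F t, ReflTransGen R.Step a (g (e a))) :
    ReflTransGen R.Step t ((topLayer F e t).subst g) := by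
  induction t with
  | var x => exact h _ (Set.mem_singleton _)
  | func f ts ih =>
    rw [aliens] at h
    rw [topLayer]
    split_ifs at h ⊢
    · exact reduces_func f fun i => ih i fun a ha => h a (Set.mem_iUnion.2 ⟨i, ha⟩)
    · exact h _ (Set.mem_singleton _)

/-- If the system governing a layer is confluent, then confluence at the aliens of a term implies
confluence at the term. -/
theorem IsLayer.confluentAt [Infinite V] {R R' : TRS L V} (hF : R.IsLayer R' F)
    (hR' : R'.IsConfluent) {s : L.Term V} (hs : aliens F s ⊆ R.confluentTerms) :
    ConfluentAt R.Step s := by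
  intro t u ht hu
  let I : Set (L.Term V) := aliens F t ∪ aliens F u
  have hI : I.Finite := (aliens_finite t).union (aliens_finite u)
  have hIc : I ⊆ R.confluentTerms :=
    Set.union_subset (hF.reduces ht hs).1 (hF.reduces hu hs).1
  let q : L.Term V → Quotient R.joinSetoid := Quotient.mk _
  -- There may be more joinability classes than variables, but only those of the finitely many
  -- aliens of `t` and `u` need distinct names.
  obtain ⟨e', he'⟩ := exists_injOn_of_finite (β := V) (hI.image q)
  let e : L.Term V → V := fun a => e' (q a)
  have he : ∀ a ∈ R.confluentTerms, ∀ b, R.Step a b → e a = e b := fun a ha b hab =>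
    congrArg e' (Quotient.sound (.inr
      ⟨ha, mem_confluentTerms_of_reduces ha (.single hab), b, .single hab, .refl⟩))
  have hg : ∀ y : V, ∃ c ∈ termsOver R.sig V, ∀ a ∈ I, e a = y → ReflTransGen R.Step a c := by
    intro y
    by_cases hy : ∃ a ∈ I, e a = y
    · obtain ⟨a, ha, rfl⟩ := hy
      obtain ⟨c, hac, hc⟩ := (hIc ha).2.exists_common_reduct
        (J := {b ∈ I | e b = e a}) (hI.subset (Set.sep_subset _ _)) (by
          rintro b ⟨hb, hba⟩
          have := he' (Set.mem_image_of_mem q ha) (Set.mem_image_of_mem q hb) hba.symm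
          rcases Quotient.exact this with rfl | ⟨-, -, h⟩
          · exact ⟨_, .refl, .refl⟩
          · exact h)
      exact ⟨c, mem_termsOver_of_reduces hac (hIc ha).1, fun b hb hba => hc b ⟨hb, hba⟩⟩
    · push Not at hy
      -- An unused name may go to any term over the signature.
      exact ⟨var y, var_mem_termsOver y, fun a ha h => (hy a ha h).elim⟩
  choose g hg hgI using hg
  obtain ⟨k, htk, huk⟩ := isConfluent_iff.1 hR' _
    (termsOver_mono hF.subset_sig (topLayer_mem_termsOver e s)) _ _
    ((hF.reduces ht hs).2 e he) ((hF.reduces hu hs).2 e he)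
  have lift : ∀ {a b : L.Term V}, ReflTransGen R'.Step a b →
      ReflTransGen R.Step (a.subst g) (b.subst g) := fun h =>
    h.lift (fun a : L.Term V => a.subst g) fun _ _ =>
      Step.subst hF.sig_subset hF.rules_subset hg
  exact ⟨k.subst g,
    (reduces_topLayer_subst fun a ha => hgI _ a (.inl ha) rfl).trans (lift htk),
    (reduces_topLayer_subst fun a ha => hgI _ a (.inr ha) rfl).trans (lift huk)⟩

/-- A TRS is confluent if every symbol of its signature lies in a layer governed by a confluent
TRS. -/
theorem isConfluent_of_isLayer [Infinite V] {R : TRS L V}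
    (h : ∀ f ∈ R.sig, ∃ F R', f ∈ F ∧ R.IsLayer R' F ∧ R'.IsConfluent) : R.IsConfluent := by
  -- The claim covers all `F` at once, since an argument is cut at the `F` chosen for the root above
  -- it.
  suffices key : ∀ t ∈ termsOver R.sig V,
      t ∈ R.confluentTerms ∧ ∀ F, aliens F t ⊆ R.confluentTerms from
    isConfluent_iff.2 fun s hs => (key s hs).1.2
  intro t ht
  induction t with
  | var x =>
    have hx : (var x : L.Term V) ∈ R.confluentTerms := ⟨ht, confluentAt_var x⟩
    exact ⟨hx, fun F => Set.singleton_subset_iff.2 hx⟩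
  | @func n f ts ih =>
    have hts := func_mem_termsOver.1 ht
    have hf : func f ts ∈ R.confluentTerms := by
      obtain ⟨F, R', hfF, hF, hR'⟩ := h _ hts.1
      refine ⟨ht, hF.confluentAt hR' ?_⟩
      rw [aliens, if_pos hfF]
      exact Set.iUnion_subset fun i => (ih i (hts.2 i)).2 F
    refine ⟨hf, fun F => ?_⟩
    rw [aliens]
    split_ifs
    · exact Set.iUnion_subset fun i => (ih i (hts.2 i)).2 F
    · exact Set.singleton_subset_iff.2 hf

end TRS

end Layers

end Rewriting

/-! ### The layers of the union -/

theorem mainTheorem7 {L : FirstOrder.Language} {V : Type*} [Countable V] [Infinite V]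
    (R₁ R₂ : Rewriting.TRS L V) (B D₁ D₂ : Set (Rewriting.FunSymbol L))
    (hB : B = R₁.sig ∩ R₂.sig) (hD₁ : D₁ = R₁.sig \ R₂.sig) (hD₂ : D₂ = R₂.sig \ R₁.sig)
    (h₁ : R₁.rules ⊆
      Rewriting.termsOver B V ×ˢ Rewriting.termsOver B V ∪
        Rewriting.rootedTermsOver D₁ R₁.sig V ×ˢ Rewriting.rootedTermsOver D₁ R₁.sig V)
    (h₂ : R₂.rules ⊆
      Rewriting.termsOver B V ×ˢ Rewriting.termsOver B V ∪
        Rewriting.rootedTermsOver D₂ R₂.sig V ×ˢ Rewriting.rootedTermsOver D₂ R₂.sig V)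
    (hshared : R₁.rules ∩ Rewriting.termsOver B V ×ˢ Rewriting.termsOver B V =
      R₂.rules ∩ Rewriting.termsOver B V ×ˢ Rewriting.termsOver B V)
    (hconf₁ : R₁.IsConfluent) (hconf₂ : R₂.IsConfluent) :
    (R₁.union R₂).IsConfluent := by
  subst hB hD₁ hD₂
  have compl_mono : ∀ {X Y F : Set (Rewriting.FunSymbol L)} {ρ : L.Term V × L.Term V},
      X ⊆ Fᶜ → ρ ∈ Rewriting.rootedTermsOver X Y V ×ˢ Rewriting.rootedTermsOver X Y V →
      Rewriting.HasRootIn Fᶜ ρ.1 ∧ Rewriting.HasRootIn Fᶜ ρ.2 :=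
    fun hX hρ => ⟨hρ.1.2.mono hX, hρ.2.2.mono hX⟩
  have shared₁ : ∀ ρ ∈ R₁.rules, ρ ∈ Rewriting.termsOver (R₁.sig ∩ R₂.sig) V ×ˢ
      Rewriting.termsOver (R₁.sig ∩ R₂.sig) V → ρ ∈ R₂.rules :=
    fun ρ hρ hB => (hshared.subset ⟨hρ, hB⟩).1
  have shared₂ : ∀ ρ ∈ R₂.rules, ρ ∈ Rewriting.termsOver (R₁.sig ∩ R₂.sig) V ×ˢ
      Rewriting.termsOver (R₁.sig ∩ R₂.sig) V → ρ ∈ R₁.rules :=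
    fun ρ hρ hB => (hshared.superset ⟨hρ, hB⟩).1
  have inter_left :=
    Rewriting.termsOver_mono (V := V) (Set.inter_subset_left (s := R₁.sig) (t := R₂.sig))
  have inter_right :=
    Rewriting.termsOver_mono (V := V) (Set.inter_subset_right (s := R₁.sig) (t := R₂.sig))
  refine Rewriting.TRS.isConfluent_of_isLayer fun f hf => ?_
  by_cases hf₁ : f ∈ R₁.sig
  · by_cases hf₂ : f ∈ R₂.sig
    -- For a shared symbol the intersection serves as the layer: all rules outside it are rooted in
    -- `D₁` or `D₂`, and equality of the shared rules puts those of `R₂` into `R₁`.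
    · refine ⟨R₁.sig ∩ R₂.sig, R₁, ⟨hf₁, hf₂⟩, ⟨Set.inter_subset_left, Set.subset_union_left,
        Set.subset_union_left, ?_⟩, hconf₁⟩
      rintro ρ (hρ | hρ)
      · rcases h₁ hρ with hB | hD
        · exact .inl ⟨hρ, hB⟩
        · exact .inr (compl_mono (fun g hg hg' => hg.2 hg'.2) hD)
      · rcases h₂ hρ with hB | hD
        · exact .inl ⟨shared₂ ρ hρ hB, hB⟩
        · exact .inr (compl_mono (fun g hg hg' => hg.2 hg'.1) hD)
    · refine ⟨R₁.sig, R₁, hf₁, ⟨subset_rfl, Set.subset_union_left,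
        Set.subset_union_left, ?_⟩, hconf₁⟩
      rintro ρ (hρ | hρ)
      · exact .inl ⟨hρ, R₁.rules_subset hρ⟩
      · rcases h₂ hρ with hB | hD
        · exact .inl ⟨shared₂ ρ hρ hB, inter_left hB.1, inter_left hB.2⟩
        · exact .inr (compl_mono (fun g hg => hg.2) hD)
  · refine ⟨R₂.sig, R₂, hf.resolve_left hf₁, ⟨subset_rfl, Set.subset_union_right,
      Set.subset_union_right, ?_⟩, hconf₂⟩
    rintro ρ (hρ | hρ)
    · rcases h₁ hρ with hB | hD
      · exact .inl ⟨shared₁ ρ hρ hB, inter_right hB.1, inter_right hB.2⟩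
      · exact .inr (compl_mono (fun g hg => hg.2) hD)
    · exact .inl ⟨hρ, R₂.rules_subset hρ⟩
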